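/- Let $0<q<1$ and $\alpha,\beta>-1$ be real. Write $(a;q)_\infty=\prod_{i\ge0}(1-aq^i)$, $(a;q)_s=(a;q)_\infty/(aq^s;q)_\infty$, $[k]_q=\frac{1-q^k}{1-q}$, $D_qf(x)=\frac{f(x)-f(qx)}{(1-q)x}$, $\int_0^1f(x)\,d_qx=(1-q)\sum_{n\ge0}q^nf(q^n)$ and $\omega^{(\alpha,\beta)}(x;q)=(qx;q)_\beta\,x^\alpha$. There is a unique sequence of monic real polynomials $p_n^{(\alpha,\beta)}$ (the monic little $q$-Jacobi polynomials) with $\deg p_n^{(\alpha,\beta)}=n$ and $$\int_0^1p_n^{(\alpha,\beta)}(x)\,x^k\,\omega^{(\alpha,\beta)}(x;q)\,d_qx=0\qquad(0\le k\le n-1);$$ let $h_n^{(\alpha,\beta)}=\int_0^1p_n^{(\alpha,\beta)}(x)^2\,\omega^{(\alpha,\beta)}(x;q)\,d_qx$ be its norms. On real polynomials consider the skew symmetric form $$\langle f,g\rangle_s=\int_0^1\bigl(f(x)D_qg(x)-g(x)D_qf(x)\bigr)\,\omega^{(\alpha+1,\beta+1)}(x;q)\,d_qx .$$ For $m\ge0$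 put $$Q_{2m+1}=p^{(\alpha,\beta)}_{2m+1},\qquad Q_{2m}=\sum_{j=0}^{m}\left(\prod_{k=1}^{m-j}\frac{[2m-2k+2]_q\,h_{2m-2k+1}^{(\alpha+1,\beta+1)}+q^{\beta+1}[2m-2k+1]_q\,h_{2m-2k+2}^{(\alpha,\beta)}}{[2m-2k+1]_q\,h_{2m-2k}^{(\alpha+1,\beta+1)}+q^{\beta+1}[2m-2k]_q\,h_{2m-2k+1}^{(\alpha,\beta)}}\right)p^{(\alpha,\beta)}_{2j}.$$ Then each $Q_n$ is monic of degree $n$, and there are nonzero constants $u_n$ such that for all $m,n\ge0$ $$\langle Q_{2n},Q_{2m+1}\rangle_s=-\langle Q_{2m+1},Q_{2n}\rangle_s=u_n\delta_{n,m},\qquad\langle Q_{2m},Q_{2n}\rangle_s=\langle Q_{2m+1},Q_{2n+1}\rangle_s=0 .$$ Moreover, a sequence $(\widetilde Q_n)_{n\ge0}$ of monic real polynomials with $\deg\widetilde Q_n=n$ satisfies these relations for some constants $(u_n)$ if and only if, for every $m$, $\widetilde Q_{2m}=Q_{2m}$ and $\widetilde Q_{2m+1}=p^{(\alpha,\beta)}_{2m+1}+\gamma_mQ_{2m}$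 for some real constant $\gamma_m$. -/

import Mathlib

open Polynomial

noncomputable section

namespace LittleQJacobi

/-- The infinite `q`-shifted factorial `(a;q)_∞ = ∏_{i ≥ 0} (1 - a q^i)`. -/
def qPochInf (a q : ℝ) : ℝ := ∏' i : ℕ, (1 - a * q ^ i)

/-- `(a;q)_s = (a;q)_∞ / (a q^s;q)_∞` for a real index `s`. -/
def qPoch (a q s : ℝ) : ℝ := qPochInf a q / qPochInf (a * q ^ s) q

/-- The `q`-number `[k]_q = (1 - q^k) / (1 - q)`. -/
def qNumber (q : ℝ) (k : ℕ) : ℝ := (1 - q ^ k) / (1 - q)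

/-- The `q`-difference operator `D_q f(x) = (f(x) - f(qx)) / ((1 - q) x)`. It is only ever
evaluated at the lattice points `x = q^n`, which are nonzero. -/
def qDiff (q : ℝ) (f : ℝ → ℝ) (x : ℝ) : ℝ := (f x - f (q * x)) / ((1 - q) * x)

/-- The Jackson integral `∫_0^1 f(x) d_q x = (1 - q) ∑_{n ≥ 0} q^n f(q^n)`. -/
def jackson (q : ℝ) (f : ℝ → ℝ) : ℝ := (1 - q) * ∑' n : ℕ, q ^ n * f (q ^ n)

/-- The little `q`-Jacobi weight `ω^{(α,β)}(x;q) = (qx;q)_β x^α`. -/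
def weight (q α β x : ℝ) : ℝ := qPoch (q * x) q β * x ^ α

/-- The symmetric form `∫_0^1 f(x) g(x) ω(x) d_q x` on polynomials. -/
def symmForm (q : ℝ) (ω : ℝ → ℝ) (f g : ℝ[X]) : ℝ :=
  jackson q fun x => f.eval x * g.eval x * ω x

/-- The skew symmetric form `∫_0^1 (f D_q g - g D_q f) ω d_q x` on polynomials. -/
def skewForm (q : ℝ) (ω : ℝ → ℝ) (f g : ℝ[X]) : ℝ :=
  jackson q fun x =>
    (f.eval x * qDiff q (fun y => g.eval y) x - g.eval x * qDiff q (fun y => f.eval y) x) * ω x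

/-- `p` consists of monic polynomials, `p n` of degree `n`, with
`∫_0^1 p_n(x) x^k ω(x) d_q x = 0` for `0 ≤ k ≤ n - 1`. -/
def IsMonicOrthogonal (q : ℝ) (ω : ℝ → ℝ) (p : ℕ → ℝ[X]) : Prop :=
  ∀ n, (p n).Monic ∧ (p n).natDegree = n ∧ ∀ k < n, symmForm q ω (p n) (X ^ k) = 0

/-- `Q` consists of monic polynomials, `Q n` of degree `n`, that are skew orthogonal with
normalisations `u`. -/
def IsMonicSkewOrthogonal (q : ℝ) (ω : ℝ → ℝ) (Q : ℕ → ℝ[X]) (u : ℕ → ℝ) : Prop :=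
  (∀ n, (Q n).Monic ∧ (Q n).natDegree = n) ∧
  ∀ m n,
    skewForm q ω (Q (2 * n)) (Q (2 * m + 1)) = (if n = m then u n else 0) ∧
    skewForm q ω (Q (2 * m + 1)) (Q (2 * n)) = -(if n = m then u n else 0) ∧
    skewForm q ω (Q (2 * m)) (Q (2 * n)) = 0 ∧
    skewForm q ω (Q (2 * m + 1)) (Q (2 * n + 1)) = 0

/-- The monic little `q`-Jacobi polynomials `p_n^{(α,β)}(x;q)`, built by orthogonalising
`1, x, x^2, …` against the weight `ω^{(α,β)}`. -/
def poly (q α β : ℝ) (n : ℕ) : ℝ[X] :=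
  X ^ n - ∑ k : Fin n,
    C (symmForm q (weight q α β) (X ^ n) (poly q α β k) /
      symmForm q (weight q α β) (poly q α β k) (poly q α β k)) * poly q α β k
termination_by n
decreasing_by all_goals exact k.2

/-- The norms `h_n^{(α,β)} = ∫_0^1 p_n^{(α,β)}(x;q)^2 ω^{(α,β)}(x;q) d_q x`. -/
def norm (q α β : ℝ) (n : ℕ) : ℝ :=
  symmForm q (weight q α β) (poly q α β n) (poly q α β n)

/-- The explicit even-degree polynomials. In the product `k ≤ m`, so that no natural-number
subtraction truncates. -/
def skewEven (q α β : ℝ) (m : ℕ) : ℝ[X] :=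
  ∑ j ∈ Finset.range (m + 1),
    C (∏ k ∈ Finset.Icc 1 (m - j),
      (qNumber q (2 * m - 2 * k + 2) * norm q (α + 1) (β + 1) (2 * m - 2 * k + 1) +
          q ^ (β + 1) * qNumber q (2 * m - 2 * k + 1) * norm q α β (2 * m - 2 * k + 2)) /
        (qNumber q (2 * m - 2 * k + 1) * norm q (α + 1) (β + 1) (2 * m - 2 * k) +
          q ^ (β + 1) * qNumber q (2 * m - 2 * k) * norm q α β (2 * m - 2 * k + 1))) *
      poly q α β (2 * j)

end LittleQJacobi

end

noncomputable section

namespace LittleQJacobi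

/-! The form is tridiagonal in the basis `poly q α β`, and the rest is linear algebra. On the
lattice $x=q^n$ the weight $\omega^{(\alpha+1,\beta+1)}$ is
$x(1-q^{\beta+1}x)\,\omega^{(\alpha,\beta)}$, and a $q$-Pearson equation makes $D_q$, paired with
the raised weight, adjoint to an operator that raises degrees by at most one. Hence both halves of
$\langle p_i,p_j\rangle_s$ vanish by orthogonality once $i+1<j$ (`Admissible.skew_poly_of_lt`).
Comparing leading coefficients gives the neighbouring entries $c_n=[n+1]_q
h_n^{(\alpha+1,\beta+1)}+q^{\beta+1}[n]_q h_{n+1}^{(\alpha,\beta)}>0$ (`Admissible.skew_poly_succ`).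

For such a matrix the odd $p_{2m+1}$ are already mutually orthogonal, and
$E_{m+1}=p_{2m+2}+(c_{2m+1}/c_{2m})E_m$ cancels the pairing with $p_{2m+1}$; unrolling the recursion
gives the stated product. Uniqueness follows because the form is nondegenerate on polynomials of
degree below $2m$ (`IsTridiagonal.nondegenerate`). -/

/-- The range of the parameters. -/
structure Admissible (q α β : ℝ) : Prop where
  q_pos : 0 < q
  q_lt_one : q < 1
  lt_left : -1 < α
  lt_right : -1 < β

theorem Admissible.succ {q α β : ℝ} (h : Admissible q α β) : Admissible q (α + 1) (β + 1) :=
  ⟨h.q_pos, h.q_lt_one, by linarith [h.lt_left], by linarith [h.lt_right]⟩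

/-! ### The weight on the lattice -/

theorem summable_neg_mul_pow {q : ℝ} (hq0 : 0 < q) (hq1 : q < 1) (a : ℝ) :
    Summable fun i : ℕ => -(a * q ^ i) :=
  ((summable_geometric_of_lt_one hq0.le hq1).mul_left a).neg

theorem qPochInf_eq_mul {q : ℝ} (hq0 : 0 < q) (hq1 : q < 1) (a : ℝ) :
    qPochInf a q = (1 - a) * qPochInf (a * q) q := by
  have he : (fun i : ℕ => 1 - a * q ^ (i + 1)) = fun i : ℕ => 1 - a * q * q ^ i :=
    funext fun i => by ring
  have hm : Multipliable fun i : ℕ => 1 - a * q ^ (i + 1) := by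
    rw [he]
    simpa only [← sub_eq_add_neg] using
      Real.multipliable_one_add_of_summable (summable_neg_mul_pow hq0 hq1 (a * q))
  have ht := tprod_eq_zero_mul' (f := fun i : ℕ => 1 - a * q ^ i) hm
  rw [qPochInf, qPochInf, ht, he, pow_zero, mul_one]

theorem qPochInf_pos {q a : ℝ} (hq0 : 0 < q) (hq1 : q < 1) (ha : a < 1) :
    0 < qPochInf a q := by
  have hpos : ∀ i : ℕ, 0 < 1 + -(a * q ^ i) := by
    intro i
    have h1 : q ^ i ≤ 1 := pow_le_one₀ hq0.le hq1.le
    have h2 : 0 < q ^ i := pow_pos hq0 i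
    rcases le_or_gt a 0 with h | h <;> nlinarith
  have := Real.rexp_tsum_eq_tprod hpos
    (Real.summable_log_one_add_of_summable (summable_neg_mul_pow hq0 hq1 a))
  have h2 : qPochInf a q = Real.exp (∑' i : ℕ, Real.log (1 + -(a * q ^ i))) := by
    rw [this]; rfl
  rw [h2]
  exact Real.exp_pos _

section Weight

variable {q α β : ℝ}

theorem Admissible.rpow_lt_one (h : Admissible q α β) : q ^ (β + 1) < 1 :=
  Real.rpow_lt_one h.q_pos.le h.q_lt_one (by linarith [h.lt_right])

theorem Admissible.rpow_mul_pow_lt_one (h : Admissible q α β) (n : ℕ) :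
    q ^ (β + 1) * q ^ n < 1 :=
  (mul_le_of_le_one_right (Real.rpow_nonneg h.q_pos.le _)
    (pow_le_one₀ h.q_pos.le h.q_lt_one.le)).trans_lt h.rpow_lt_one

theorem Admissible.weight_pow (h : Admissible q α β) (n : ℕ) :
    weight q α β (q ^ n) =
      qPochInf (q ^ (n + 1)) q / qPochInf (q ^ (β + 1) * q ^ n) q * (q ^ α) ^ n := by
  have h1 : q * q ^ n * q ^ β = q ^ (β + 1) * q ^ n := by
    rw [Real.rpow_add h.q_pos, Real.rpow_one]; ring
  have h2 : (q ^ n) ^ α = (q ^ α) ^ n := by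
    rw [← Real.rpow_natCast, ← Real.rpow_natCast, ← Real.rpow_mul h.q_pos.le,
      ← Real.rpow_mul h.q_pos.le, mul_comm]
  rw [weight, qPoch, h1, h2, pow_succ']

theorem Admissible.weight_pow_pos (h : Admissible q α β) (n : ℕ) : 0 < weight q α β (q ^ n) := by
  rw [h.weight_pow]
  exact mul_pos (div_pos
    (qPochInf_pos h.q_pos h.q_lt_one (pow_lt_one₀ h.q_pos.le h.q_lt_one n.succ_ne_zero))
    (qPochInf_pos h.q_pos h.q_lt_one (h.rpow_mul_pow_lt_one n)))
    (pow_pos (Real.rpow_pos_of_pos h.q_pos _) _)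

/-- The $q$-Pearson equation. It drives both the ratio test for convergence and the summation by
parts. -/
theorem Admissible.weight_pow_succ (h : Admissible q α β) (n : ℕ) :
    (1 - q ^ (n + 1)) * weight q α β (q ^ (n + 1)) =
      q ^ α * (1 - q ^ (β + 1) * q ^ n) * weight q α β (q ^ n) := by
  rw [h.weight_pow, h.weight_pow, qPochInf_eq_mul h.q_pos h.q_lt_one (q ^ (n + 1)),
    qPochInf_eq_mul h.q_pos h.q_lt_one (q ^ (β + 1) * q ^ n)]
  have h1 : (1 - q ^ (β + 1) * q ^ n) ≠ 0 := (sub_pos.2 (h.rpow_mul_pow_lt_one n)).ne'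
  have h2 := (qPochInf_pos h.q_pos h.q_lt_one (h.rpow_mul_pow_lt_one (n + 1))).ne'
  rw [show q ^ (β + 1) * q ^ n * q = q ^ (β + 1) * q ^ (n + 1) by ring,
    show q ^ (n + 1) * q = q ^ (n + 1 + 1) by ring]
  rw [pow_succ (q ^ α)]
  field_simp

theorem Admissible.weight_succ_pow (h : Admissible q α β) (n : ℕ) :
    weight q (α + 1) (β + 1) (q ^ n) =
      q ^ n * (1 - q ^ (β + 1) * q ^ n) * weight q α β (q ^ n) := by
  rw [h.weight_pow, h.succ.weight_pow, qPochInf_eq_mul h.q_pos h.q_lt_one (q ^ (β + 1) * q ^ n)]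
  have h1 : (1 - q ^ (β + 1) * q ^ n) ≠ 0 := (sub_pos.2 (h.rpow_mul_pow_lt_one n)).ne'
  have h2 := (qPochInf_pos h.q_pos h.q_lt_one (h.rpow_mul_pow_lt_one (n + 1))).ne'
  rw [show q ^ (β + 1) * q ^ n * q = q ^ (β + 1) * q ^ (n + 1) by ring,
    show q ^ (β + 1 + 1) * q ^ n = q ^ (β + 1) * q ^ (n + 1) by
      rw [Real.rpow_add_one h.q_pos.ne']; ring,
    Real.rpow_add_one h.q_pos.ne' α, mul_pow]
  field_simp

theorem Admissible.summable_weight (h : Admissible q α β) :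
    Summable fun n : ℕ => q ^ n * weight q α β (q ^ n) := by
  have hlt : q ^ (α + 1) < 1 :=
    Real.rpow_lt_one h.q_pos.le h.q_lt_one (by linarith [h.lt_left])
  have hpos : ∀ n : ℕ, 0 < q ^ n * weight q α β (q ^ n) := fun n =>
    mul_pos (pow_pos h.q_pos n) (h.weight_pow_pos n)
  -- By the Pearson equation consecutive terms have ratio tending to $q^{\alpha+1}$, which is below
  -- 1 because $\alpha>-1$.
  refine summable_of_ratio_test_tendsto_lt_one hlt
    (Filter.Eventually.of_forall fun n => (hpos n).ne') ?_
  have hq : Filter.Tendsto (fun n : ℕ => q ^ n) Filter.atTop (nhds 0) :=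
    tendsto_pow_atTop_nhds_zero_of_lt_one h.q_pos.le h.q_lt_one
  have hlim : Filter.Tendsto (fun n : ℕ => q ^ (α + 1) * (1 - q ^ (β + 1) * q ^ n) /
      (1 - q ^ (n + 1))) Filter.atTop (nhds (q ^ (α + 1) * (1 - q ^ (β + 1) * 0) / (1 - 0))) :=
    ((hq.const_mul _).const_sub 1 |>.const_mul _).div
      (((Filter.tendsto_add_atTop_iff_nat 1).2 hq).const_sub 1) (by norm_num)
  simp only [mul_zero, sub_zero, mul_one, div_one] at hlim
  refine hlim.congr fun n => ?_
  have h1 : (1 - q ^ (n + 1)) ≠ 0 :=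
    (sub_pos.2 (pow_lt_one₀ h.q_pos.le h.q_lt_one n.succ_ne_zero)).ne'
  rw [Real.norm_of_nonneg (hpos _).le, Real.norm_of_nonneg (hpos _).le,
    div_eq_div_iff h1 (hpos n).ne', Real.rpow_add_one h.q_pos.ne']
  have := h.weight_pow_succ n
  linear_combination (-q ^ (n + 1)) * this

theorem Admissible.summable_eval (h : Admissible q α β) (f : ℝ[X]) :
    Summable fun n : ℕ => q ^ n * (f.eval (q ^ n) * weight q α β (q ^ n)) := by
  obtain ⟨M, hM⟩ := (isCompact_Icc (a := (0 : ℝ)) (b := 1)).exists_bound_of_continuousOn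
    (f := fun x => f.eval x) f.continuous.continuousOn
  refine Summable.of_norm_bounded (h.summable_weight.mul_left M) fun n => ?_
  have hpos := mul_pos (pow_pos h.q_pos n) (h.weight_pow_pos n)
  have hn := hM (q ^ n) ⟨(pow_pos h.q_pos n).le, pow_le_one₀ h.q_pos.le h.q_lt_one.le⟩
  rw [show q ^ n * (f.eval (q ^ n) * weight q α β (q ^ n)) =
    f.eval (q ^ n) * (q ^ n * weight q α β (q ^ n)) by ring, norm_mul,
    Real.norm_of_nonneg hpos.le]
  exact mul_le_mul_of_nonneg_right hn hpos.le

end Weight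

/-- Jackson integration of polynomials against the weight, as a linear functional. -/
def Admissible.functional {q α β : ℝ} (h : Admissible q α β) : ℝ[X] →ₗ[ℝ] ℝ where
  toFun f := jackson q fun x => f.eval x * weight q α β x
  map_add' f g := by
    unfold jackson
    rw [← mul_add, ← (h.summable_eval f).tsum_add (h.summable_eval g)]
    congr 1
    exact tsum_congr fun n => by simp only [eval_add]; ring
  map_smul' c f := by
    unfold jackson
    rw [RingHom.id_apply, smul_eq_mul, mul_left_comm, ← tsum_mul_left (a := c)]
    congr 1
    exact tsum_congr fun n => by simp only [eval_smul, smul_eq_mul]; ring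

section Functional

variable {q α β : ℝ}

theorem Admissible.functional_apply (h : Admissible q α β) (f : ℝ[X]) :
    h.functional f = (1 - q) * ∑' n : ℕ, q ^ n * (f.eval (q ^ n) * weight q α β (q ^ n)) := rfl

theorem Admissible.symmForm_eq (h : Admissible q α β) (f g : ℝ[X]) :
    symmForm q (weight q α β) f g = h.functional (f * g) := by
  simp only [symmForm, Admissible.functional, LinearMap.coe_mk, AddHom.coe_mk, eval_mul]

/-- The lattice is infinite, so a nonzero polynomial cannot vanish on all of it. -/
theorem Admissible.functional_sq_pos (h : Admissible q α β) {f : ℝ[X]} (hf : f ≠ 0) :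
    0 < h.functional (f * f) := by
  have hinj : Function.Injective fun n : ℕ => q ^ n :=
    (pow_right_strictAnti₀ h.q_pos h.q_lt_one).injective
  obtain ⟨n, hn⟩ : ∃ n : ℕ, f.eval (q ^ n) ≠ 0 := by
    by_contra! H
    exact hf (f.eq_zero_of_infinite_isRoot
      ((Set.infinite_range_of_injective hinj).mono (by rintro _ ⟨n, rfl⟩; exact H n)))
  rw [h.functional_apply]
  refine mul_pos (sub_pos.2 h.q_lt_one) ((h.summable_eval _).tsum_pos (fun k => ?_) n ?_)
  · rw [eval_mul]
    exact mul_nonneg (pow_pos h.q_pos k).le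
      (mul_nonneg (mul_self_nonneg _) (h.weight_pow_pos k).le)
  · rw [eval_mul]
    exact mul_pos (pow_pos h.q_pos n) (mul_pos (mul_self_pos.2 hn) (h.weight_pow_pos n))

theorem Admissible.functional_succ (h : Admissible q α β) (f : ℝ[X]) :
    h.succ.functional f = h.functional (X * (1 - C (q ^ (β + 1)) * X) * f) := by
  rw [h.functional_apply, h.succ.functional_apply]
  congr 1
  refine tsum_congr fun n => ?_
  rw [h.weight_succ_pow]
  simp only [eval_mul, eval_sub, eval_X, eval_C, eval_one]
  ring

end Functional

/-! ### The `q`-difference operator on polynomials -/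

/-- The `q`-difference operator acting on polynomials. -/
def qDiffPoly (q : ℝ) : ℝ[X] →ₗ[ℝ] ℝ[X] where
  toFun f := C (1 - q)⁻¹ * (f - f.comp (C q * X)).divX
  map_add' f g := by
    ext n
    simp only [coeff_C_mul, coeff_divX, coeff_sub, coeff_add, add_comp]
    ring
  map_smul' c f := by
    ext n
    simp only [coeff_C_mul, coeff_divX, coeff_sub, coeff_smul, smul_comp, smul_eq_mul,
      RingHom.id_apply]
    ring

theorem qDiffPoly_coeff (q : ℝ) (f : ℝ[X]) (n : ℕ) :
    (qDiffPoly q f).coeff n = qNumber q (n + 1) * f.coeff (n + 1) := by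
  simp only [qDiffPoly, LinearMap.coe_mk, AddHom.coe_mk, coeff_C_mul, coeff_divX, coeff_sub,
    comp_C_mul_X_coeff, qNumber]
  ring

theorem eval_qDiffPoly (q : ℝ) (f : ℝ[X]) {x : ℝ} (hx : x ≠ 0) :
    (qDiffPoly q f).eval x = qDiff q (fun y => f.eval y) x := by
  have h0 : (f - f.comp (C q * X)).coeff 0 = 0 := by
    simp [coeff_sub, comp_C_mul_X_coeff]
  have h1 := congrArg (eval x) (divX_mul_X_add (f - f.comp (C q * X)))
  simp only [h0, eval_mul, eval_X, eval_sub, eval_comp, eval_C, map_zero, add_zero] at h1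
  simp only [qDiffPoly, LinearMap.coe_mk, AddHom.coe_mk, eval_mul, eval_C, qDiff]
  rw [← h1]
  field_simp

theorem degree_qDiffPoly_lt (q : ℝ) {f : ℝ[X]} {n : ℕ} (hf : f.degree < (n + 1 : ℕ)) :
    (qDiffPoly q f).degree < n := by
  rw [degree_lt_iff_coeff_zero] at hf ⊢
  intro k hk
  rw [qDiffPoly_coeff, hf (k + 1) (by omega), mul_zero]

/-- The adjoint of the `q`-difference operator with respect to the two weights. -/
def qDiffAdjoint (q α β : ℝ) (f : ℝ[X]) : ℝ[X] :=
  C (1 - q)⁻¹ * ((1 - C (q ^ (β + 1)) * X) * f -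
    C (q ^ (α + 1))⁻¹ * ((1 - X) * f.comp (C q⁻¹ * X)))

theorem degree_qDiffAdjoint_lt (q α β : ℝ) {f : ℝ[X]} {n : ℕ} (hf : f.degree < n) :
    (qDiffAdjoint q α β f).degree < (n + 1 : ℕ) := by
  rw [degree_lt_iff_coeff_zero] at hf ⊢
  intro k hk
  obtain ⟨k, rfl⟩ : ∃ j, k = j + 1 := ⟨k - 1, by omega⟩
  have h1 := hf k (by omega)
  have h2 := hf (k + 1) (by omega)
  simp only [qDiffAdjoint, coeff_C_mul, coeff_sub, sub_mul, one_mul, mul_assoc, coeff_X_mul,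
    comp_C_mul_X_coeff, h1, h2]
  ring

/-- Summation by parts: shift the sum containing $g(qx)$ by one lattice step and rewrite the shifted
weight by the Pearson equation. -/
theorem Admissible.functional_mul_qDiffPoly {q α β : ℝ} (h : Admissible q α β) (f g : ℝ[X]) :
    h.succ.functional (f * qDiffPoly q g) = h.functional (g * qDiffAdjoint q α β f) := by
  have hq : (1 - q) ≠ 0 := (sub_pos.2 h.q_lt_one).ne'
  have hq0 := h.q_pos.ne'
  have hα : q ^ (α + 1) ≠ 0 := (Real.rpow_pos_of_pos h.q_pos _).ne'
  set F : ℝ[X] := (1 - C (q ^ (β + 1)) * X) * f * g with hF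
  set G : ℝ[X] := C (q ^ (α + 1))⁻¹ * ((1 - X) * f.comp (C q⁻¹ * X)) * g with hG
  have hFG : g * qDiffAdjoint q α β f = C (1 - q)⁻¹ * (F - G) := by
    rw [qDiffAdjoint, hF, hG]; ring
  have hs := h.summable_eval G
  -- There is no boundary term: the factor $1-x$ of `G` vanishes at $x=q^0=1$.
  have hshift : ∑' n : ℕ, q ^ n * (G.eval (q ^ n) * weight q α β (q ^ n)) =
      ∑' n : ℕ, q ^ (n + 1) * (G.eval (q ^ (n + 1)) * weight q α β (q ^ (n + 1))) := by
    rw [hs.tsum_eq_zero_add]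
    simp [hG]
  rw [hFG, h.functional_apply, h.succ.functional_apply]
  congr 1
  have h1 : ∑' n : ℕ, q ^ n * ((C (1 - q)⁻¹ * (F - G)).eval (q ^ n) * weight q α β (q ^ n)) =
      (1 - q)⁻¹ * (∑' n : ℕ, q ^ n * (F.eval (q ^ n) * weight q α β (q ^ n)) -
        ∑' n : ℕ, q ^ n * (G.eval (q ^ n) * weight q α β (q ^ n))) := by
    rw [← (h.summable_eval F).tsum_sub hs, ← tsum_mul_left]
    refine tsum_congr fun n => ?_
    simp only [eval_mul, eval_sub, eval_C]
    ring
  have hs' := (summable_nat_add_iff 1).2 hs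
  rw [h1, hshift, ← (h.summable_eval F).tsum_sub hs', ← tsum_mul_left]
  refine tsum_congr fun n => ?_
  have hx : q ^ n ≠ 0 := pow_ne_zero n hq0
  have hw := h.weight_pow_succ n
  rw [eval_mul, eval_qDiffPoly q g hx, h.weight_succ_pow, qDiff]
  simp only [hF, hG, eval_mul, eval_sub, eval_C, eval_X, eval_one, eval_comp]
  rw [show q⁻¹ * q ^ (n + 1) = q ^ n by rw [pow_succ']; field_simp,
    show q * q ^ n = q ^ (n + 1) by ring]
  have hw' : q ^ (n + 1) * ((q ^ (α + 1))⁻¹ * ((1 - q ^ (n + 1)) * f.eval (q ^ n)) *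
      g.eval (q ^ (n + 1)) * weight q α β (q ^ (n + 1))) =
      q ^ n * (1 - q ^ (β + 1) * q ^ n) * weight q α β (q ^ n) * f.eval (q ^ n) *
        g.eval (q ^ (n + 1)) := by
    have hα' : q ^ α ≠ 0 := (Real.rpow_pos_of_pos h.q_pos _).ne'
    calc _ = q ^ (n + 1) * (q ^ (α + 1))⁻¹ * ((1 - q ^ (n + 1)) * weight q α β (q ^ (n + 1))) *
          f.eval (q ^ n) * g.eval (q ^ (n + 1)) := by ring
      _ = _ := by
        rw [hw, Real.rpow_add_one hq0, pow_succ']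
        field_simp
  rw [hw']
  field_simp

/-! ### Monic families of polynomials -/

theorem degree_C_mul_le_degree (c : ℝ) (f : ℝ[X]) : (C c * f).degree ≤ f.degree := by
  rw [C_mul']; exact degree_smul_le c f

theorem eq_zero_of_degree_lt_zero {f : ℝ[X]} (hf : f.degree < (0 : ℕ)) : f = 0 := by
  ext k
  exact (degree_lt_iff_coeff_zero f 0).1 hf k k.zero_le

/-- `P` consists of monic polynomials, `P n` of degree `n`. -/
def IsMonicFamily (P : ℕ → ℝ[X]) : Prop := ∀ n, (P n).Monic ∧ (P n).natDegree = n

theorem isMonicFamily_X_pow : IsMonicFamily fun n => X ^ n :=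
  fun n => ⟨monic_X_pow n, natDegree_X_pow n⟩

theorem IsMonicFamily.degree_eq {P : ℕ → ℝ[X]} (hP : IsMonicFamily P) (n : ℕ) :
    (P n).degree = n := by
  rw [degree_eq_natDegree (hP n).1.ne_zero, (hP n).2]

theorem IsMonicFamily.coeff_self {P : ℕ → ℝ[X]} (hP : IsMonicFamily P) (n : ℕ) :
    (P n).coeff n = 1 := by
  have := (hP n).1.coeff_natDegree
  rwa [(hP n).2] at this

theorem IsMonicFamily.degree_lt {P : ℕ → ℝ[X]} (hP : IsMonicFamily P) {k n : ℕ} (hk : k < n) :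
    (P k).degree < n := by
  rw [hP.degree_eq]; exact_mod_cast hk

theorem degree_lt_of_coeff_eq_zero {f : ℝ[X]} {n : ℕ} (hf : f.degree < (n + 1 : ℕ))
    (h0 : f.coeff n = 0) : f.degree < n := by
  rw [degree_lt_iff_coeff_zero] at hf ⊢
  intro k hk
  rcases hk.eq_or_lt with rfl | hk
  · exact h0
  · exact hf k hk

theorem IsMonicFamily.degree_sub_lt {P R : ℕ → ℝ[X]} (hP : IsMonicFamily P)
    (hR : IsMonicFamily R) (n : ℕ) : (P n - R n).degree < n := by
  refine degree_lt_of_coeff_eq_zero ?_ ?_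
  · exact (degree_sub_le _ _).trans_lt
      (max_lt (hP.degree_lt n.lt_succ_self) (hR.degree_lt n.lt_succ_self))
  · rw [coeff_sub, hP.coeff_self, hR.coeff_self, sub_self]

theorem degree_sub_C_coeff_mul_lt {P : ℕ → ℝ[X]} (hP : IsMonicFamily P) {f : ℝ[X]} {n : ℕ}
    (hf : f.degree < (n + 1 : ℕ)) : (f - C (f.coeff n) * P n).degree < n := by
  refine degree_lt_of_coeff_eq_zero ?_ ?_
  · refine (degree_sub_le _ _).trans_lt (max_lt hf ?_)
    exact (degree_C_mul_le_degree _ _).trans_lt (hP.degree_lt n.lt_succ_self)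
  · rw [coeff_sub, coeff_C_mul, hP.coeff_self, mul_one, sub_self]

theorem map_eq_zero_of_degree_lt {P : ℕ → ℝ[X]} (hP : IsMonicFamily P) (φ : ℝ[X] →ₗ[ℝ] ℝ) {n : ℕ}
    (hφ : ∀ k < n, φ (P k) = 0) {f : ℝ[X]} (hf : f.degree < n) : φ f = 0 := by
  induction n generalizing f with
  | zero =>
    rw [eq_zero_of_degree_lt_zero hf, map_zero]
  | succ n ih =>
    have h1 := ih (fun k hk => hφ k (by omega)) (degree_sub_C_coeff_mul_lt hP hf)
    rw [map_sub, C_mul', map_smul, hφ n n.lt_succ_self, smul_zero, sub_zero] at h1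
    exact h1

/-- A functional that kills all degrees below $n$ sees only the coefficient of $x^n$, so any other
monic polynomial of degree $n$ may serve as the test. -/
theorem map_eq_coeff_mul {P R : ℕ → ℝ[X]} (hP : IsMonicFamily P) (hR : IsMonicFamily R)
    (φ : ℝ[X] →ₗ[ℝ] ℝ) {n : ℕ} (hφ : ∀ k < n, φ (P k) = 0) {f : ℝ[X]}
    (hf : f.degree < (n + 1 : ℕ)) : φ f = f.coeff n * φ (R n) := by
  have h1 := map_eq_zero_of_degree_lt hP φ hφ (degree_sub_C_coeff_mul_lt hR hf)
  rw [map_sub, C_mul', map_smul, smul_eq_mul] at h1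
  linarith

/-! ### Monic orthogonal polynomials -/

section Orthogonal

variable {q α β : ℝ}

theorem Admissible.functional_poly_mul_self (h : Admissible q α β) (n : ℕ) :
    norm q α β n = h.functional (poly q α β n * poly q α β n) := h.symmForm_eq _ _

theorem poly_eq_X_pow_sub (q α β : ℝ) (n : ℕ) :
    poly q α β n = X ^ n - ∑ k : Fin n,
      C (symmForm q (weight q α β) (X ^ n) (poly q α β k) /
        symmForm q (weight q α β) (poly q α β k) (poly q α β k)) * poly q α β k := by
  rw [poly]

theorem isMonicFamily_poly (q α β : ℝ) : IsMonicFamily (poly q α β) := by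
  intro n
  induction n using Nat.strong_induction_on with
  | _ n ih =>
    have hdeg : (∑ k : Fin n, C (symmForm q (weight q α β) (X ^ n) (poly q α β k) /
        symmForm q (weight q α β) (poly q α β k) (poly q α β k)) * poly q α β k).degree
          < (n : WithBot ℕ) := by
      refine (degree_sum_le _ _).trans_lt ((Finset.sup_lt_iff (WithBot.bot_lt_coe n)).2
        fun k _ => (degree_C_mul_le_degree _ _).trans_lt ?_)
      rw [degree_eq_natDegree (ih k k.2).1.ne_zero, (ih k k.2).2]
      exact WithBot.coe_lt_coe.2 k.2
    rw [poly_eq_X_pow_sub]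
    refine ⟨?_, ?_⟩
    · rw [sub_eq_add_neg]
      exact monic_X_pow_add (by rwa [degree_neg])
    · refine natDegree_eq_of_degree_eq_some ?_
      rw [degree_sub_eq_left_of_degree_lt (by rwa [degree_X_pow]), degree_X_pow]

theorem Admissible.functional_poly_mul_poly (h : Admissible q α β) {n k : ℕ} (hk : k < n) :
    h.functional (poly q α β n * poly q α β k) = 0 := by
  induction n using Nat.strong_induction_on generalizing k with
  | _ n ih =>
    have hne : h.functional (poly q α β k * poly q α β k) ≠ 0 :=
      (h.functional_sq_pos (isMonicFamily_poly q α β k).1.ne_zero).ne'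
    rw [poly_eq_X_pow_sub q α β n, sub_mul, map_sub, Finset.sum_mul, map_sum,
      Finset.sum_eq_single (⟨k, hk⟩ : Fin n)]
    · rw [mul_assoc, C_mul', map_smul, smul_eq_mul, h.symmForm_eq, h.symmForm_eq,
        div_mul_cancel₀ _ hne, sub_self]
    · intro j _ hj
      have hj' : (j : ℕ) ≠ k := fun e => hj (Fin.ext e)
      have : h.functional (poly q α β j * poly q α β k) = 0 := by
        rcases lt_or_gt_of_ne hj' with hlt | hlt
        · rw [mul_comm]; exact ih k hk hlt
        · exact ih j j.2 hlt
      rw [mul_assoc, C_mul', map_smul, this, smul_zero]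
    · exact fun H => absurd (Finset.mem_univ _) H

theorem Admissible.functional_poly_mul (h : Admissible q α β) {n : ℕ} {f : ℝ[X]}
    (hf : f.degree < n) : h.functional (poly q α β n * f) = 0 :=
  map_eq_zero_of_degree_lt (isMonicFamily_poly q α β)
    (h.functional.comp (LinearMap.mulLeft ℝ (poly q α β n)))
    (fun _ hk => h.functional_poly_mul_poly hk) hf

/-- Two monic candidates differ in degree below $n$, and both are orthogonal to that difference, so
its square integrates to zero. -/
theorem Admissible.isMonicOrthogonal_iff (h : Admissible q α β) (p : ℕ → ℝ[X]) :
    IsMonicOrthogonal q (weight q α β) p ↔ p = poly q α β := by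
  constructor
  · intro hp
    have hm : IsMonicFamily p := fun n => ⟨(hp n).1, (hp n).2.1⟩
    funext n
    have hd := hm.degree_sub_lt (isMonicFamily_poly q α β) n
    by_contra hne
    refine (h.functional_sq_pos (sub_ne_zero.2 hne)).ne' ?_
    have h1 : h.functional (p n * (p n - poly q α β n)) = 0 :=
      map_eq_zero_of_degree_lt isMonicFamily_X_pow
        (h.functional.comp (LinearMap.mulLeft ℝ (p n)))
        (fun k hk => by simpa [h.symmForm_eq] using (hp n).2.2 k hk) hd
    rw [sub_mul, map_sub, h1, h.functional_poly_mul hd, sub_zero]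
  · rintro rfl n
    refine ⟨(isMonicFamily_poly q α β n).1, (isMonicFamily_poly q α β n).2, fun k hk => ?_⟩
    rw [h.symmForm_eq]
    exact h.functional_poly_mul (isMonicFamily_X_pow.degree_lt hk)

theorem Admissible.norm_pos (h : Admissible q α β) (n : ℕ) : 0 < norm q α β n := by
  rw [h.functional_poly_mul_self]
  exact h.functional_sq_pos (isMonicFamily_poly q α β n).1.ne_zero

end Orthogonal

/-! ### The skew symmetric form in the basis of orthogonal polynomials -/

/-- The skew symmetric form as a bilinear map. -/
def Admissible.skew {q α β : ℝ} (h : Admissible q α β) : ℝ[X] →ₗ[ℝ] ℝ[X] →ₗ[ℝ] ℝ :=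
  LinearMap.mk₂ ℝ (fun f g => h.succ.functional (f * qDiffPoly q g - g * qDiffPoly q f))
    (fun f f' g => by rw [← map_add, map_add (qDiffPoly q)]; congr 1; ring)
    (fun c f g => by
      rw [← map_smul, map_smul (qDiffPoly q), smul_sub, smul_mul_assoc, mul_smul_comm])
    (fun f g g' => by rw [← map_add, map_add (qDiffPoly q)]; congr 1; ring)
    (fun c f g => by
      rw [← map_smul, map_smul (qDiffPoly q), smul_sub, smul_mul_assoc, mul_smul_comm])

section Skew

variable {q α β : ℝ}

theorem Admissible.skew_apply (h : Admissible q α β) (f g : ℝ[X]) :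
    h.skew f g =
      h.succ.functional (f * qDiffPoly q g) - h.succ.functional (g * qDiffPoly q f) := by
  rw [Admissible.skew, LinearMap.mk₂_apply, map_sub]

theorem Admissible.skew_swap (h : Admissible q α β) (f g : ℝ[X]) :
    h.skew f g = -h.skew g f := by
  rw [h.skew_apply, h.skew_apply, neg_sub]

theorem Admissible.skewForm_eq (h : Admissible q α β) (f g : ℝ[X]) :
    skewForm q (weight q (α + 1) (β + 1)) f g = h.skew f g := by
  rw [Admissible.skew, LinearMap.mk₂_apply, h.succ.functional_apply, skewForm, jackson]
  congr 1
  refine tsum_congr fun n => ?_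
  have hx : q ^ n ≠ 0 := pow_ne_zero n h.q_pos.ne'
  simp only [eval_sub, eval_mul, eval_qDiffPoly q _ hx]

theorem Admissible.functional_mul_qDiffPoly_poly (h : Admissible q α β) {n : ℕ} {f : ℝ[X]}
    (hf : f.degree < n) : h.succ.functional (f * qDiffPoly q (poly q α β (n + 1))) = 0 := by
  rw [h.functional_mul_qDiffPoly]
  exact h.functional_poly_mul (degree_qDiffAdjoint_lt q α β hf)

theorem degree_X_mul_one_sub_mul_lt (c : ℝ) {f : ℝ[X]} {n : ℕ} (hf : f.degree < n) :
    (X * (1 - C c * X) * f).degree < ((n + 2 : ℕ) : WithBot ℕ) := by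
  rw [degree_lt_iff_coeff_zero] at hf ⊢
  intro k hk
  obtain ⟨k, rfl⟩ : ∃ j, k = j + 2 := ⟨k - 2, by omega⟩
  simp only [mul_assoc, coeff_X_mul, sub_mul, one_mul, coeff_sub, coeff_C_mul,
    hf k (by omega), hf (k + 1) (by omega)]
  ring

theorem Admissible.functional_poly_mul_qDiffPoly (h : Admissible q α β) {n : ℕ} {f : ℝ[X]}
    (hf : f.degree < n) : h.succ.functional (poly q α β (n + 1) * qDiffPoly q f) = 0 := by
  rw [h.functional_succ, mul_left_comm]
  refine h.functional_poly_mul ?_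
  cases n with
  | zero =>
    rw [eq_zero_of_degree_lt_zero hf, map_zero, mul_zero, degree_zero]
    exact WithBot.bot_lt_coe _
  | succ n => exact degree_X_mul_one_sub_mul_lt _ (degree_qDiffPoly_lt q hf)

theorem Admissible.skew_poly_of_lt (h : Admissible q α β) {i j : ℕ} (hij : i + 1 < j) :
    h.skew (poly q α β i) (poly q α β j) = 0 := by
  obtain ⟨n, rfl⟩ : ∃ n, j = n + 1 := ⟨j - 1, by omega⟩
  have hi := (isMonicFamily_poly q α β).degree_lt (show i < n by omega)
  rw [h.skew_apply, h.functional_mul_qDiffPoly_poly hi, h.functional_poly_mul_qDiffPoly hi,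
    sub_zero]

/-- Integration against $D_qp_{n+1}$ kills degrees below $n$, so $p_n^{(\alpha,\beta)}$ may be
replaced by $p_n^{(\alpha+1,\beta+1)}$, which in turn sees only the leading coefficient $[n+1]_q$ of
$D_qp_{n+1}$. -/
theorem Admissible.functional_poly_mul_qDiffPoly_poly_succ (h : Admissible q α β) (n : ℕ) :
    h.succ.functional (poly q α β n * qDiffPoly q (poly q α β (n + 1))) =
      qNumber q (n + 1) * norm q (α + 1) (β + 1) n := by
  have hp := isMonicFamily_poly q α β
  have hP := isMonicFamily_poly q (α + 1) (β + 1)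
  have h1 := map_eq_coeff_mul hp hP
    (h.succ.functional.comp (LinearMap.mulRight ℝ (qDiffPoly q (poly q α β (n + 1)))))
    (n := n) (fun k hk => h.functional_mul_qDiffPoly_poly (hp.degree_lt hk))
    (hp.degree_lt n.lt_succ_self)
  have h2 := map_eq_coeff_mul hP hP
    (h.succ.functional.comp (LinearMap.mulLeft ℝ (poly q (α + 1) (β + 1) n)))
    (n := n) (fun k hk => h.succ.functional_poly_mul_poly hk)
    (degree_qDiffPoly_lt q (hp.degree_lt (n + 1).lt_succ_self))
  rw [qDiffPoly_coeff, hp.coeff_self, mul_one] at h2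
  rw [hp.coeff_self, one_mul] at h1
  rw [h.succ.functional_poly_mul_self]
  exact h1.trans h2

/-- In terms of the lower weight, $p_{n+1}$ is tested against $x(1-q^{\beta+1}x)D_qp_n$, whose
coefficient at $x^{n+1}$ is $-q^{\beta+1}[n]_q$. For $n=0$ both sides are zero. -/
theorem Admissible.functional_poly_succ_mul_qDiffPoly_poly (h : Admissible q α β) (n : ℕ) :
    h.succ.functional (poly q α β (n + 1) * qDiffPoly q (poly q α β n)) =
      -(q ^ (β + 1) * qNumber q n * norm q α β (n + 1)) := by
  have hp := isMonicFamily_poly q α β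
  cases n with
  | zero =>
    have : qDiffPoly q (poly q α β 0) = 0 := by
      ext k
      rw [qDiffPoly_coeff, coeff_eq_zero_of_degree_lt (hp.degree_lt k.succ_pos), mul_zero,
        coeff_zero]
    simp [this, qNumber]
  | succ n =>
    have hd : (qDiffPoly q (poly q α β (n + 1))).degree < (n + 1 : ℕ) :=
      degree_qDiffPoly_lt q (hp.degree_lt (n + 1).lt_succ_self)
    have h1 := map_eq_coeff_mul hp hp
      (h.functional.comp (LinearMap.mulLeft ℝ (poly q α β (n + 2))))
      (n := n + 2) (fun k hk => h.functional_poly_mul_poly hk)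
      (degree_X_mul_one_sub_mul_lt (q ^ (β + 1)) hd)
    have hc : (X * (1 - C (q ^ (β + 1)) * X) * qDiffPoly q (poly q α β (n + 1))).coeff (n + 2) =
        -(q ^ (β + 1) * qNumber q (n + 1)) := by
      simp only [mul_assoc, coeff_X_mul, sub_mul, one_mul, coeff_sub, coeff_C_mul,
        qDiffPoly_coeff, hp.coeff_self,
        coeff_eq_zero_of_degree_lt (hp.degree_lt (n + 1).lt_succ_self)]
      ring
    rw [hc] at h1
    rw [h.functional_succ, mul_left_comm, h.functional_poly_mul_self, ← neg_mul]
    exact h1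

theorem Admissible.skew_poly_succ (h : Admissible q α β) (n : ℕ) :
    h.skew (poly q α β n) (poly q α β (n + 1)) =
      qNumber q (n + 1) * norm q (α + 1) (β + 1) n +
        q ^ (β + 1) * qNumber q n * norm q α β (n + 1) := by
  rw [h.skew_apply, h.functional_poly_mul_qDiffPoly_poly_succ,
    h.functional_poly_succ_mul_qDiffPoly_poly, sub_neg_eq_add]

theorem Admissible.skew_poly_succ_pos (h : Admissible q α β) (n : ℕ) :
    0 < h.skew (poly q α β n) (poly q α β (n + 1)) := by
  rw [h.skew_poly_succ]
  have hq : 0 < 1 - q := sub_pos.2 h.q_lt_one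
  have h1 : 0 < qNumber q (n + 1) :=
    div_pos (sub_pos.2 (pow_lt_one₀ h.q_pos.le h.q_lt_one n.succ_ne_zero)) hq
  have h2 : 0 ≤ qNumber q n :=
    div_nonneg (sub_nonneg.2 (pow_le_one₀ h.q_pos.le h.q_lt_one.le)) hq.le
  exact add_pos_of_pos_of_nonneg (mul_pos h1 (h.succ.norm_pos n))
    (mul_nonneg (mul_nonneg (Real.rpow_nonneg h.q_pos.le _) h2) (h.norm_pos _).le)

end Skew

/-! ### Skew orthogonalisation in a basis where the form is tridiagonal -/

/-- A skew symmetric form whose Gram matrix in the monic basis `p` is tridiagonal, with nonzero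
entries next to the diagonal. -/
structure IsTridiagonal (S : ℝ[X] →ₗ[ℝ] ℝ[X] →ₗ[ℝ] ℝ) (p : ℕ → ℝ[X]) : Prop where
  swap : ∀ f g, S f g = -S g f
  monic : IsMonicFamily p
  far : ∀ i j, i + 1 < j → S (p i) (p j) = 0
  ne_zero : ∀ i, S (p i) (p (i + 1)) ≠ 0

/-- The even-degree skew orthogonal polynomials, defined recursively. -/
def evenFamily (S : ℝ[X] →ₗ[ℝ] ℝ[X] →ₗ[ℝ] ℝ) (p : ℕ → ℝ[X]) : ℕ → ℝ[X]
  | 0 => p 0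
  | m + 1 => p (2 * m + 2) +
      (S (p (2 * m + 1)) (p (2 * m + 2)) / S (p (2 * m)) (p (2 * m + 1))) • evenFamily S p m

namespace IsTridiagonal

variable {S : ℝ[X] →ₗ[ℝ] ℝ[X] →ₗ[ℝ] ℝ} {p : ℕ → ℝ[X]}

theorem self (h : IsTridiagonal S p) (f : ℝ[X]) : S f f = 0 := by
  linarith [h.swap f f]

theorem eq_zero (h : IsTridiagonal S p) {i j : ℕ} (h1 : i + 1 ≠ j) (h2 : j + 1 ≠ i) :
    S (p i) (p j) = 0 := by
  rcases lt_trichotomy i j with hij | rfl | hij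
  · exact h.far i j (by omega)
  · exact h.self _
  · rw [h.swap, h.far j i (by omega), neg_zero]

theorem evenFamily_monic (h : IsTridiagonal S p) (m : ℕ) :
    (evenFamily S p m).Monic ∧ (evenFamily S p m).natDegree = 2 * m := by
  induction m with
  | zero => exact h.monic 0
  | succ m ih =>
    have hlt : ((S (p (2 * m + 1)) (p (2 * m + 2)) / S (p (2 * m)) (p (2 * m + 1))) •
        evenFamily S p m).degree < (p (2 * m + 2)).degree := by
      refine (degree_smul_le _ _).trans_lt ?_
      rw [degree_eq_natDegree ih.1.ne_zero, ih.2, h.monic.degree_eq]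
      exact_mod_cast (by omega : 2 * m < 2 * m + 2)
    rw [evenFamily]
    refine ⟨(h.monic _).1.add_of_left hlt, ?_⟩
    rw [natDegree_add_eq_left_of_degree_lt hlt, (h.monic _).2]
    ring

/-- Only even-indexed `p` occur in `evenFamily`. As two even indices are never adjacent, this makes
even members pair to zero. -/
theorem map_evenFamily (φ : ℝ[X] →ₗ[ℝ] ℝ) (hφ : ∀ j, φ (p (2 * j)) = 0) (m : ℕ) :
    φ (evenFamily S p m) = 0 := by
  induction m with
  | zero => exact hφ 0
  | succ m ih => rw [evenFamily, map_add, map_smul, ih, smul_zero, add_zero]; exact hφ (m + 1)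

theorem even_even (h : IsTridiagonal S p) (m n : ℕ) :
    S (evenFamily S p m) (evenFamily S p n) = 0 := by
  refine map_evenFamily _ (fun j => ?_) n
  rw [h.swap, neg_eq_zero]
  exact map_evenFamily _ (fun i => h.eq_zero (by omega) (by omega)) m

theorem even_odd (h : IsTridiagonal S p) (n m : ℕ) :
    S (evenFamily S p n) (p (2 * m + 1)) =
      if n = m then S (p (2 * n)) (p (2 * n + 1)) else 0 := by
  induction n with
  | zero =>
    rw [evenFamily]
    split_ifs with hm
    · subst hm; rfl
    · exact h.eq_zero (by omega) (by omega)
  | succ n ih =>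
    rw [evenFamily, map_add, map_smul, LinearMap.add_apply, LinearMap.smul_apply, ih, smul_eq_mul]
    by_cases hm : n = m
    · subst hm
      -- The ratio in the recursion is the one for which the two neighbours of $p_{2n+1}$ contribute
      -- opposite amounts.
      rw [if_pos rfl, if_neg (by omega), div_mul_cancel₀ _ (h.ne_zero _),
        h.swap (p (2 * n + 2)), neg_add_cancel]
    · rw [if_neg hm, mul_zero, add_zero]
      split_ifs with hm'
      · subst hm'; rfl
      · exact h.eq_zero (by omega) (by omega)

theorem odd_odd (h : IsTridiagonal S p) (m n : ℕ) : S (p (2 * m + 1)) (p (2 * n + 1)) = 0 :=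
  h.eq_zero (by omega) (by omega)

theorem evenFamily_apply_eq_zero (h : IsTridiagonal S p) {m : ℕ} {f : ℝ[X]}
    (hf : f.degree < (2 * m + 1 : ℕ)) : S (evenFamily S p m) f = 0 := by
  refine map_eq_zero_of_degree_lt h.monic _ (fun k hk => ?_) hf
  rcases Nat.even_or_odd' k with ⟨j, rfl | rfl⟩
  · rw [h.swap, neg_eq_zero]
    exact map_evenFamily _ (fun i => h.eq_zero (by omega) (by omega)) m
  · rw [h.even_odd, if_neg (by omega)]

theorem odd_apply_eq_zero (h : IsTridiagonal S p) {m : ℕ} {f : ℝ[X]}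
    (hf : f.degree < (2 * m : ℕ)) : S (p (2 * m + 1)) f = 0 :=
  map_eq_zero_of_degree_lt h.monic _ (fun k hk => h.eq_zero (by omega) (by omega)) hf

/-- The leading coefficient of `d` is detected by `p (2 * j + 1)` if its degree is $2j$, and by
`evenFamily S p j` if it is $2j+1$. The even bound matters: $2j<2m$ forces $2j+1<2m$, so the test
polynomial is admissible. -/
theorem nondegenerate (h : IsTridiagonal S p) {m : ℕ} {d : ℝ[X]} (hd : d.degree < (2 * m : ℕ))
    (h0 : ∀ f : ℝ[X], f.degree < (2 * m : ℕ) → S d f = 0) : d = 0 := by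
  by_contra hne
  have hlead : d.coeff d.natDegree ≠ 0 := by simpa using hne
  have hk : d.natDegree < 2 * m := (natDegree_lt_iff_degree_lt hne).2 hd
  have hself : d.degree < (d.natDegree + 1 : ℕ) := by
    rw [degree_eq_natDegree hne]; exact_mod_cast Nat.lt_succ_self _
  rcases Nat.even_or_odd' d.natDegree with ⟨j, hj | hj⟩
  · rw [hj] at hlead hself
    have h1 := map_eq_coeff_mul h.monic h.monic (S (p (2 * j + 1))) (n := 2 * j)
      (fun k hk => h.odd_apply_eq_zero (h.monic.degree_lt hk)) hself
    rw [h.swap, h0 _ (h.monic.degree_lt (by omega)), neg_zero, h.swap (p (2 * j + 1))] at h1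
    exact mul_ne_zero hlead (neg_ne_zero.2 (h.ne_zero (2 * j))) h1.symm
  · rw [hj] at hlead hself
    have hE : (evenFamily S p j).degree < (2 * m : ℕ) := by
      rw [degree_eq_natDegree (h.evenFamily_monic j).1.ne_zero, (h.evenFamily_monic j).2]
      exact_mod_cast (by omega : 2 * j < 2 * m)
    have h1 := map_eq_coeff_mul h.monic h.monic (S (evenFamily S p j)) (n := 2 * j + 1)
      (fun k hk => h.evenFamily_apply_eq_zero (h.monic.degree_lt hk)) hself
    rw [h.swap, h0 _ hE, neg_zero, h.even_odd, if_pos rfl] at h1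
    exact mul_ne_zero hlead (h.ne_zero (2 * j)) h1.symm

/-- Adding multiples of the even members to the odd members keeps skew orthogonality. -/
theorem skewOrthogonal_add (h : IsTridiagonal S p) (γ : ℕ → ℝ) (m n : ℕ) :
    S (evenFamily S p n) (p (2 * m + 1) + γ m • evenFamily S p m) =
        (if n = m then S (p (2 * n)) (p (2 * n + 1)) else 0) ∧
      S (p (2 * m + 1) + γ m • evenFamily S p m) (p (2 * n + 1) + γ n • evenFamily S p n) = 0 := by
  constructor
  · rw [map_add, map_smul, h.even_even, smul_zero, add_zero, h.even_odd]
  · simp only [map_add, map_smul, LinearMap.add_apply, LinearMap.smul_apply, h.even_even,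
      h.odd_odd, smul_eq_mul, h.swap (p (2 * m + 1)) (evenFamily S p n), h.even_odd]
    -- For equal indices the two cross terms carry the same $\gamma$ with opposite signs; otherwise
    -- each is zero.
    by_cases hmn : n = m
    · subst hmn; simp
    · rw [if_neg hmn, if_neg (Ne.symm hmn)]; ring

/-- Any skew orthogonal monic family is the standard one up to adding multiples of the even members
to the odd members. -/
theorem eq_of_skewOrthogonal (h : IsTridiagonal S p) {Q : ℕ → ℝ[X]} (hQ : IsMonicFamily Q)
    (h01 : ∀ m n, n ≠ m → S (Q (2 * n)) (Q (2 * m + 1)) = 0)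
    (h00 : ∀ m n, S (Q (2 * m)) (Q (2 * n)) = 0)
    (h11 : ∀ m n, S (Q (2 * m + 1)) (Q (2 * n + 1)) = 0) (m : ℕ) :
    Q (2 * m) = evenFamily S p m ∧ ∃ γ : ℝ, Q (2 * m + 1) = p (2 * m + 1) +
      γ • evenFamily S p m := by
  have hEm := h.evenFamily_monic m
  have hEdeg : (evenFamily S p m).degree = (2 * m : ℕ) := by
    rw [degree_eq_natDegree hEm.1.ne_zero, hEm.2]
  have hEc : (evenFamily S p m).coeff (2 * m) = 1 := by
    have := hEm.1.coeff_natDegree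
    rwa [hEm.2] at this
  have hlt : ((2 * m : ℕ) : WithBot ℕ) < (2 * m + 1 : ℕ) := by exact_mod_cast Nat.lt_succ_self _
  have hE0 : ∀ f : ℝ[X], f.degree < (2 * m : ℕ) → S (evenFamily S p m) f = 0 := fun f hf =>
    h.evenFamily_apply_eq_zero (hf.trans hlt)
  constructor
  · refine sub_eq_zero.1 (h.nondegenerate (m := m) ?_ fun f hf => ?_)
    · refine degree_lt_of_coeff_eq_zero ((degree_sub_le _ _).trans_lt
        (max_lt (hQ.degree_lt (Nat.lt_succ_self _)) (hEdeg ▸ hlt))) ?_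
      rw [coeff_sub, hQ.coeff_self, hEc, sub_self]
    · rw [map_sub, LinearMap.sub_apply, hE0 f hf, sub_zero]
      refine map_eq_zero_of_degree_lt hQ _ (fun k hk => ?_) hf
      rcases Nat.even_or_odd' k with ⟨j, rfl | rfl⟩
      · exact h00 _ _
      · exact h01 _ _ (by omega)
  · have hD := hQ.degree_sub_lt h.monic (2 * m + 1)
    -- This choice of $\gamma$ removes the $x^{2m}$ term, bringing the remainder below degree $2m$,
    -- where nondegeneracy applies.
    refine ⟨(Q (2 * m + 1) - p (2 * m + 1)).coeff (2 * m), ?_⟩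
    rw [← sub_eq_iff_eq_add', ← sub_eq_zero]
    refine h.nondegenerate (m := m) ?_ fun f hf => ?_
    · refine degree_lt_of_coeff_eq_zero ((degree_sub_le _ _).trans_lt (max_lt hD
        ((degree_smul_le _ _).trans_lt (hEdeg ▸ hlt)))) ?_
      rw [coeff_sub (Q (2 * m + 1) - _), coeff_smul, hEc, smul_eq_mul, mul_one, sub_self]
    · have hQ0 : S (Q (2 * m + 1)) f = 0 := by
        refine map_eq_zero_of_degree_lt hQ _ (fun k hk => ?_) hf
        rcases Nat.even_or_odd' k with ⟨j, rfl | rfl⟩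
        · rw [h.swap, h01 _ _ (by omega), neg_zero]
        · exact h11 _ _
      rw [map_sub, map_sub, map_smul, LinearMap.sub_apply, LinearMap.sub_apply,
        LinearMap.smul_apply, hE0 f hf, hQ0, h.odd_apply_eq_zero hf]
      simp

end IsTridiagonal

/-! ### Return to the little $q$-Jacobi case and the explicit product formula -/

section Main

variable {q α β : ℝ}

theorem Admissible.isTridiagonal (h : Admissible q α β) :
    IsTridiagonal h.skew (poly q α β) where
  swap := h.skew_swap
  monic := isMonicFamily_poly q α β
  far _ _ hij := h.skew_poly_of_lt hij
  ne_zero n := (h.skew_poly_succ_pos n).ne'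

theorem prod_Icc_one_succ (f : ℕ → ℝ) (n : ℕ) :
    ∏ k ∈ Finset.Icc 1 (n + 1), f k = f 1 * ∏ k ∈ Finset.Icc 1 n, f (k + 1) := by
  induction n with
  | zero => simp
  | succ n ih =>
    rw [Finset.prod_Icc_succ_top (by omega), ih, Finset.prod_Icc_succ_top (by omega), mul_assoc]

theorem skewEven_zero (q α β : ℝ) : skewEven q α β 0 = poly q α β 0 := by
  simp [skewEven]

theorem Admissible.skewEven_succ (h : Admissible q α β) (m : ℕ) :
    skewEven q α β (m + 1) = poly q α β (2 * m + 2) +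
      (h.skew (poly q α β (2 * m + 1)) (poly q α β (2 * m + 2)) /
        h.skew (poly q α β (2 * m)) (poly q α β (2 * m + 1))) • skewEven q α β m := by
  rw [skewEven, Finset.sum_range_succ, add_comm, skewEven, Finset.smul_sum]
  congr 1
  · simp [mul_add]
  · refine Finset.sum_congr rfl fun j hj => ?_
    have hj' : m + 1 - j = m - j + 1 := by
      have := Finset.mem_range.1 hj
      omega
    rw [← C_mul', ← mul_assoc, ← C_mul]
    congr 2
    -- The factor $k=1$ is the ratio in the recursion; the remaining factors, reindexed by $k\mapsto
    -- k+1$, form the product for $m$.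
    rw [hj', prod_Icc_one_succ, h.skew_poly_succ, h.skew_poly_succ]
    congr 1
    exact Finset.prod_congr rfl fun k _ => by
      rw [show 2 * (m + 1) - 2 * (k + 1) = 2 * m - 2 * k by omega]

theorem Admissible.skewEven_eq (h : Admissible q α β) (m : ℕ) :
    skewEven q α β m = evenFamily h.skew (poly q α β) m := by
  induction m with
  | zero => rw [skewEven_zero, evenFamily]
  | succ m ih => rw [h.skewEven_succ, evenFamily, ih]

/-- Taking $\gamma=0$ gives the explicit family; general $\gamma$ gives the converse half of the
characterisation. The normalisations do not depend on $\gamma$. -/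
theorem Admissible.isMonicSkewOrthogonal (h : Admissible q α β) {Q : ℕ → ℝ[X]} (γ : ℕ → ℝ)
    (h0 : ∀ m, Q (2 * m) = skewEven q α β m)
    (h1 : ∀ m, Q (2 * m + 1) = poly q α β (2 * m + 1) + γ m • skewEven q α β m) :
    IsMonicSkewOrthogonal q (weight q (α + 1) (β + 1)) Q
      fun n => h.skew (poly q α β (2 * n)) (poly q α β (2 * n + 1)) := by
  have ht := h.isTridiagonal
  simp only [h.skewEven_eq] at h0 h1
  refine ⟨fun n => ?_, fun m n => ?_⟩
  · rcases Nat.even_or_odd' n with ⟨m, rfl | rfl⟩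
    · rw [h0]; exact ht.evenFamily_monic m
    · have hE := ht.evenFamily_monic m
      have hlt : (γ m • evenFamily h.skew (poly q α β) m).degree <
          (poly q α β (2 * m + 1)).degree := by
        refine (degree_smul_le _ _).trans_lt ?_
        rw [degree_eq_natDegree hE.1.ne_zero, hE.2, ht.monic.degree_eq]
        exact_mod_cast Nat.lt_succ_self _
      rw [h1]
      refine ⟨(ht.monic _).1.add_of_left hlt, ?_⟩
      rw [natDegree_add_eq_left_of_degree_lt hlt, (ht.monic _).2]
  · simp only [h.skewForm_eq, h0, h1]
    obtain ⟨h2, h3⟩ := ht.skewOrthogonal_add γ m n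
    refine ⟨h2, ?_, ht.even_even m n, h3⟩
    rw [h.skew_swap, h2]

end Main

end LittleQJacobi

end

theorem mainTheorem11 (q α β : ℝ) (hq0 : 0 < q) (hq1 : q < 1) (hα : -1 < α) (hβ : -1 < β) :
    -- the polynomials `p_n^{(α,β)}` are the unique monic orthogonal polynomials of `ω^{(α,β)}`
    (∀ p : ℕ → Polynomial ℝ,
      LittleQJacobi.IsMonicOrthogonal q (LittleQJacobi.weight q α β) p ↔
        p = LittleQJacobi.poly q α β) ∧
    -- the explicit family is skew orthogonal for `ω^{(α+1,β+1)}`, with nonzero normalisations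
    (∀ Q : ℕ → Polynomial ℝ,
      (∀ m, Q (2 * m + 1) = LittleQJacobi.poly q α β (2 * m + 1)) →
      (∀ m, Q (2 * m) = LittleQJacobi.skewEven q α β m) →
      ∃ u : ℕ → ℝ, (∀ n, u n ≠ 0) ∧
        LittleQJacobi.IsMonicSkewOrthogonal q (LittleQJacobi.weight q (α + 1) (β + 1)) Q u) ∧
    -- and it is the only one, up to adding multiples of `Q_{2m}` to `Q_{2m+1}`
    (∀ Q : ℕ → Polynomial ℝ,
      (∃ u : ℕ → ℝ,
        LittleQJacobi.IsMonicSkewOrthogonal q (LittleQJacobi.weight q (α + 1) (β + 1)) Q u) ↔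
      ∀ m, Q (2 * m) = LittleQJacobi.skewEven q α β m ∧
        ∃ γ : ℝ, Q (2 * m + 1) =
          LittleQJacobi.poly q α β (2 * m + 1) +
            Polynomial.C γ * LittleQJacobi.skewEven q α β m) := by
  have h : LittleQJacobi.Admissible q α β := ⟨hq0, hq1, hα, hβ⟩
  refine ⟨h.isMonicOrthogonal_iff, fun Q h1 h0 => ?_, fun Q => ⟨?_, fun hQ => ?_⟩⟩
  · exact ⟨_, fun n => (h.skew_poly_succ_pos (2 * n)).ne',
      h.isMonicSkewOrthogonal (fun _ => 0) h0 fun m => by rw [h1, zero_smul, add_zero]⟩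
  · rintro ⟨u, hm, hu⟩ m
    simp only [h.skewForm_eq] at hu
    simp only [h.skewEven_eq, ← Polynomial.smul_eq_C_mul]
    exact h.isTridiagonal.eq_of_skewOrthogonal hm
      (fun m n hmn => by rw [(hu m n).1, if_neg hmn]) (fun m n => (hu m n).2.2.1)
      (fun m n => (hu m n).2.2.2) m
  · choose h0 γ h1 using hQ
    simp only [← Polynomial.smul_eq_C_mul] at h1
    exact ⟨_, h.isMonicSkewOrthogonal γ h0 h1⟩
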